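/- Let $D=(V,A)$ be a finite directed graph (parallel arcs allowed) whose vertex set is partitioned into $V_1$ and $V_2$ such that no arc goes from $V_2$ to $V_1$, and let $\delta(V_1,V_2)$ be the set of arcs from $V_1$ to $V_2$. A $(V_1,V_2)$-bibranching is a set $F\subseteq A$ such that, using only arcs of $F$, every $v\in V_1$ has a directed path to some vertex of $V_2$ and every $v\in V_2$ has a directed path from some vertex of $V_1$. Suppose that $A$ can be partitioned into $k$ $(V_1,V_2)$-bibranchings. Then $A$ can be partitioned into $k$ pairwise disjoint $(V_1,V_2)$-bibranchings $F_1,\dots,F_k$ such that, writing $N_i=F_i\cap\delta(V_1,V_2)$ and $B_i=F_i\setminus N_i$, for all $i,j\in\{1,\dots,k\}$ we have $$\bigl||F_i|-|F_j|\bigr|\le 1,\qquad \bigl||N_i|-|N_j|\bigr|\le 2,\qquad \bigl||B_i|-|B_j|\bigr|\le 2 .$$ -/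

import Mathlib

/-- A directed graph with vertex type `V` and arc type `A`; parallel arcs are allowed. -/
structure ArcDigraph (V A : Type*) where
  /-- the tail of an arc -/
  src : A → V
  /-- the head of an arc -/
  tgt : A → V

namespace ArcDigraph

/-- `V₁, V₂` is a partition of the vertex set such that no arc goes from `V₂` to `V₁`.
A digraph that has such a partition is called partitionable. -/
structure IsVertexPartition {V A : Type*} [Fintype V] [DecidableEq V]
    (D : ArcDigraph V A) (V₁ V₂ : Finset V) : Prop where
  disjoint : Disjoint V₁ V₂
  cover : V₁ ∪ V₂ = Finset.univ
  no_back_arc : ∀ a : A, ¬ (D.src a ∈ V₂ ∧ D.tgt a ∈ V₁)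

/-- The set `δ(V₁, V₂)` of arcs from `V₁` to `V₂`. -/
def delta {V A : Type*} [DecidableEq V] [Fintype A]
    (D : ArcDigraph V A) (V₁ V₂ : Finset V) : Finset A :=
  Finset.univ.filter fun a => D.src a ∈ V₁ ∧ D.tgt a ∈ V₂

/-- There is a directed path (possibly of length `0`) from `u` to `v` all of whose arcs
lie in `F`. -/
def HasPath {V A : Type*} (D : ArcDigraph V A) (F : Finset A) (u v : V) : Prop :=
  Relation.ReflTransGen (fun x y => ∃ a ∈ F, D.src a = x ∧ D.tgt a = y) u v

/-- `F` is a `(V₁, V₂)`-bibranching: in `F`, there is a path from every vertex of `V₁` to `V₂`,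
and a path from `V₁` to every vertex of `V₂`. -/
structure IsBibranching {V A : Type*} (D : ArcDigraph V A) (V₁ V₂ : Finset V)
    (F : Finset A) : Prop where
  exists_path_to : ∀ v ∈ V₁, ∃ w ∈ V₂, D.HasPath F v w
  exists_path_from : ∀ v ∈ V₂, ∃ u ∈ V₁, D.HasPath F u v

/-- `F 0, …, F (k - 1)` is a partition of the arc set into `k` `(V₁, V₂)`-bibranchings. -/
structure IsBibranchingPartition {V A : Type*} (D : ArcDigraph V A) (V₁ V₂ : Finset V)
    {k : ℕ} (F : Fin k → Finset A) : Prop where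
  bibranching : ∀ i, D.IsBibranching V₁ V₂ (F i)
  disjoint : ∀ i j, i ≠ j → Disjoint (F i) (F j)
  cover : ∀ a : A, ∃ i, a ∈ F i

end ArcDigraph

/-! The heart is an exchange of two bibranchings. Let `U` be the union of two disjoint ones and `M`
its set of arcs from `V₁` to `V₂`. Colour `M` with two colours. By Edmonds' theorem the heads of the
two colour classes are root sets of disjoint branchings inside `V₂` as soon as a cut condition
holds; the same applied to the reversed digraph serves `V₁`. Crossing arcs of one colour, together
with the two branchings grown from them, form a bibranching.

The cut condition follows if the colouring splits certain labels of the arcs, one label at the head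
and one at the tail (`cutCondition_of_splitsLabels`). Pairing arcs by head label and again by tail
label gives two matchings on `M`, whose union is bipartite, so both labellings are split at once. A
branching in `W` with root set `R` has `|W| - |R|` arcs, so all size differences are signed sums of
the colouring, each small because paired arcs cancel; a parity argument bounds the total by 1
(`exists_balanced_colouring`). Unused arcs are then distributed without spoiling the bounds
(`exists_balanced_pair`).

For `k` classes, take a partition minimising a sum of quadratic weights: exchanging an unbalanced
pair for a balanced one would lower it. -/

namespace ArcDigraph

set_option linter.unusedSectionVars false

variable {V A : Type*} [Fintype V] [DecidableEq V] [Fintype A] [DecidableEq A]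

/-! ### Edmonds' theorem for two branchings. -/

/-- The digraph with all arcs reversed. -/
def reverse (D : ArcDigraph V A) : ArcDigraph V A := ⟨D.tgt, D.src⟩

/-- The arcs of `S` entering the vertex set `X`. -/
def inArcs (D : ArcDigraph V A) (S : Finset A) (X : Finset V) : Finset A :=
  S.filter fun a => D.src a ∉ X ∧ D.tgt a ∈ X

/-- Edmonds' cut condition for packing two branchings inside `W` with root sets `R₁`, `R₂`. -/
def CutCondition (D : ArcDigraph V A) (W : Finset V) (S : Finset A) (R₁ R₂ : Finset V) : Prop :=
  ∀ X ⊆ W, X.Nonempty →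
    (if Disjoint R₁ X then 1 else 0) + (if Disjoint R₂ X then 1 else 0) ≤ (D.inArcs S X).card

theorem mem_inArcs {D : ArcDigraph V A} {S : Finset A} {X : Finset V} {a : A} :
    a ∈ D.inArcs S X ↔ a ∈ S ∧ D.src a ∉ X ∧ D.tgt a ∈ X := by
  simp [inArcs]

theorem inArcs_erase (D : ArcDigraph V A) (S : Finset A) (X : Finset V) (a : A) :
    D.inArcs (S.erase a) X = (D.inArcs S X).erase a := by
  ext b; simp only [mem_inArcs, Finset.mem_erase]; tauto

/-- Submodularity of the in-degree, the source of the uncrossing below. -/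
theorem card_inArcs_inter_add_union (D : ArcDigraph V A) (S : Finset A) (X Y : Finset V) :
    (D.inArcs S (X ∩ Y)).card + (D.inArcs S (X ∪ Y)).card ≤
      (D.inArcs S X).card + (D.inArcs S Y).card := by
  rw [← Finset.card_union_add_card_inter (D.inArcs S X),
    ← Finset.card_union_add_card_inter (D.inArcs S (X ∩ Y))]
  apply Nat.add_le_add <;> apply Finset.card_le_card <;> intro a <;>
    simp only [Finset.mem_union, Finset.mem_inter, mem_inArcs] <;> tauto

theorem HasPath.mono {D : ArcDigraph V A} {F G : Finset A} (h : F ⊆ G) {u v : V}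
    (p : D.HasPath F u v) : D.HasPath G u v :=
  Relation.ReflTransGen.mono (fun _ _ ⟨a, ha, e⟩ => ⟨a, h ha, e⟩) _ _ p

theorem HasPath.reverse {D : ArcDigraph V A} {F : Finset A} {u v : V}
    (p : D.HasPath F u v) : D.reverse.HasPath F v u := by
  induction p with
  | refl => exact Relation.ReflTransGen.refl
  | tail _ e ih =>
    obtain ⟨a, ha, rfl, rfl⟩ := e
    exact Relation.ReflTransGen.head ⟨a, ha, rfl, rfl⟩ ih

theorem CutCondition.symm {D : ArcDigraph V A} {W : Finset V} {S : Finset A} {R₁ R₂ : Finset V}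
    (h : D.CutCondition W S R₁ R₂) : D.CutCondition W S R₂ R₁ := fun X hX hn => by
  rw [add_comm]; exact h X hX hn

/-- Lovász's augmentation step. -/
theorem CutCondition.exists_arc {D : ArcDigraph V A} {W : Finset V} {S : Finset A}
    {R₁ R₂ : Finset V} (h : D.CutCondition W S R₁ R₂) (hS : ∀ a ∈ S, D.src a ∈ W)
    (h₁ : R₁ ⊂ W) :
    ∃ a ∈ S, D.src a ∈ R₁ ∧ D.tgt a ∈ W ∧ D.tgt a ∉ R₁ ∧
      D.CutCondition W (S.erase a) (insert (D.tgt a) R₁) R₂ := by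
  classical
  -- The dangerous sets: `a` may be moved into the first branching exactly when it enters none of
  -- them. A set missing `R₁` loses one entering arc but also one unit of demand.
  set P : Finset V → Prop := fun X => X ⊆ W ∧ ¬ Disjoint R₁ X ∧ (∃ v ∈ X, v ∉ R₁) ∧
    Disjoint R₂ X ∧ (D.inArcs S X).card = 1 with hP
  have key : ∀ a ∈ S, D.src a ∈ R₁ → D.tgt a ∈ W → D.tgt a ∉ R₁ →
      (∀ Y, P Y → D.src a ∉ Y → D.tgt a ∉ Y) →
      D.CutCondition W (S.erase a) (insert (D.tgt a) R₁) R₂ := by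
    intro a haS hs ht ht' hY X hX hn
    have hc := h X hX hn
    rw [inArcs_erase]
    by_cases ha : a ∈ D.inArcs S X
    · have ha' := (mem_inArcs.1 ha).2
      have hpos : 0 < (D.inArcs S X).card := Finset.card_pos.2 ⟨a, ha⟩
      rw [Finset.card_erase_of_mem ha]
      have h1 : ¬ Disjoint (insert (D.tgt a) R₁) X := by
        simp [Finset.disjoint_insert_left, ha'.2]
      rw [if_neg h1]
      by_cases d1 : Disjoint R₁ X
      · rw [if_pos d1] at hc; omega
      · rw [if_neg d1] at hc
        by_cases d2 : Disjoint R₂ X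
        · rw [if_pos d2]
          have : (D.inArcs S X).card ≠ 1 := fun h1 =>
            hY X ⟨hX, d1, ⟨_, ha'.2, ht'⟩, d2, h1⟩ ha'.1 ha'.2
          omega
        · rw [if_neg d2]; omega
    · rw [Finset.erase_eq_of_notMem ha]
      refine le_trans ?_ hc
      gcongr
      split_ifs with i1 i2
      · exact le_rfl
      · exact absurd (Finset.disjoint_of_subset_left (Finset.subset_insert _ _) i1) i2
      all_goals omega
  by_cases hex : ∃ X, P X
  · obtain ⟨X, hX, hmin⟩ : ∃ X, P X ∧ ∀ Y, P Y → X.card ≤ Y.card := by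
      have hne : ((Finset.univ : Finset (Finset V)).filter P).Nonempty := by
        obtain ⟨X, hX⟩ := hex; exact ⟨X, by simpa using hX⟩
      obtain ⟨X, hX, hm⟩ := Finset.exists_min_image _ Finset.card hne
      exact ⟨X, by simpa using hX, fun Y hY => hm Y (by simpa using hY)⟩
    obtain ⟨hXW, hX1, ⟨x, hx, hx1⟩, hX2, hXc⟩ := hX
    have hsub : X \ R₁ ⊆ X := Finset.sdiff_subset
    -- At least two arcs enter `X \ R₁` and only one enters `X`, so some arc runs from `X ∩ R₁` to
    -- `X \ R₁`.
    have h2 := h (X \ R₁) (hsub.trans hXW) ⟨x, by simp [hx, hx1]⟩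
    rw [if_pos Finset.disjoint_sdiff, if_pos (Finset.disjoint_of_subset_right hsub hX2)] at h2
    obtain ⟨a, ha, haX⟩ : ∃ a ∈ D.inArcs S (X \ R₁), a ∉ D.inArcs S X := by
      by_contra! hcon
      have := Finset.card_le_card (show D.inArcs S (X \ R₁) ⊆ D.inArcs S X from hcon)
      omega
    simp only [mem_inArcs, Finset.mem_sdiff] at ha haX
    have hsX : D.src a ∈ X := by tauto
    have hs1 : D.src a ∈ R₁ := by tauto
    refine ⟨a, ha.1, hs1, hXW ha.2.2.1, ha.2.2.2, key a ha.1 hs1 (hXW ha.2.2.1) ha.2.2.2 ?_⟩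
    rintro Y ⟨hYW, hY1, -, hY2, hYc⟩ hsY htY
    -- Uncrossing: `X ∩ Y` and `X ∪ Y` both have in-degree 1, so `X ∩ Y` is dangerous and, missing
    -- the tail of `a`, smaller than the minimal `X`.
    have hsm := D.card_inArcs_inter_add_union S X Y
    have hi := h (X ∩ Y) (Finset.inter_subset_left.trans hXW)
      ⟨D.tgt a, by simp [ha.2.2.1, htY]⟩
    have hu := h (X ∪ Y) (Finset.union_subset hXW hYW) ⟨D.tgt a, by simp [htY]⟩
    rw [if_pos (Finset.disjoint_of_subset_right Finset.inter_subset_left hX2)] at hi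
    rw [if_pos (Finset.disjoint_union_right.2 ⟨hX2, hY2⟩)] at hu
    have hi1 : ¬ Disjoint R₁ (X ∩ Y) := by
      intro hd; rw [if_pos hd] at hi; omega
    have := hmin (X ∩ Y) ⟨Finset.inter_subset_left.trans hXW, hi1,
      ⟨D.tgt a, by simp [ha.2.2.1, htY], ha.2.2.2⟩,
      Finset.disjoint_of_subset_right Finset.inter_subset_left hX2, by omega⟩
    have hlt : (X ∩ Y).card < X.card := Finset.card_lt_card
      ⟨Finset.inter_subset_left, fun hh => hsY (Finset.mem_inter.1 (hh hsX)).2⟩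
    omega
  · obtain ⟨w, hw, hw1⟩ := Finset.exists_of_ssubset h₁
    have h2 := h (W \ R₁) Finset.sdiff_subset ⟨w, by simp [hw, hw1]⟩
    rw [if_pos Finset.disjoint_sdiff] at h2
    obtain ⟨a, ha⟩ : (D.inArcs S (W \ R₁)).Nonempty := Finset.card_pos.1 (by omega)
    simp only [mem_inArcs, Finset.mem_sdiff] at ha
    have hs := hS a ha.1
    have hs1 : D.src a ∈ R₁ := by tauto
    exact ⟨a, ha.1, hs1, ha.2.2.1, ha.2.2.2, key a ha.1 hs1 ha.2.2.1 ha.2.2.2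
      fun Y hY => absurd ⟨Y, hY⟩ hex⟩

/-- The augmentation step is iterated until the root set is all of `W`. The remaining cut condition
then makes demands only for `R₂`, so a second application yields the other branching. -/
theorem CutCondition.exists_branching {D : ArcDigraph V A} {W : Finset V} {S : Finset A}
    {R₁ R₂ : Finset V} (h : D.CutCondition W S R₁ R₂) (hS : ∀ a ∈ S, D.src a ∈ W)
    (h₁ : R₁ ⊆ W) :
    ∃ B ⊆ S, B.card + R₁.card = W.card ∧ (∀ w ∈ W, ∃ u ∈ R₁, D.HasPath B u w) ∧
      D.CutCondition W (S \ B) W R₂ := by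
  induction hn : (W \ R₁).card generalizing R₁ S with
  | zero =>
    have hW : R₁ = W := h₁.antisymm (Finset.sdiff_eq_empty_iff_subset.1 (Finset.card_eq_zero.1 hn))
    subst hW
    exact ⟨∅, by simp, by simp, fun w hw => ⟨w, hw, Relation.ReflTransGen.refl⟩, by simpa using h⟩
  | succ n ih =>
    have hlt : R₁ ⊂ W := by
      refine h₁.ssubset_of_ne ?_
      rintro rfl; simp at hn
    obtain ⟨a, haS, hs, ht, ht', hc⟩ := h.exists_arc hS hlt
    have hcard : (W \ insert (D.tgt a) R₁).card = n := by
      rw [Finset.sdiff_insert, Finset.card_erase_of_mem (by simp [ht, ht']), hn]; rfl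
    obtain ⟨B, hB, hBc, hBp, hBcut⟩ := ih hc (fun b hb => hS b (Finset.mem_of_mem_erase hb))
      (Finset.insert_subset ht h₁) hcard
    have haB : a ∉ B := fun hh => Finset.notMem_erase a S (hB hh)
    refine ⟨insert a B, Finset.insert_subset haS (hB.trans (Finset.erase_subset _ _)), ?_, ?_, ?_⟩
    · rw [Finset.card_insert_of_notMem ht'] at hBc
      rw [Finset.card_insert_of_notMem haB]; omega
    · intro w hw
      obtain ⟨u, hu, p⟩ := hBp w hw
      have p' := p.mono (Finset.subset_insert a B)
      rcases Finset.mem_insert.1 hu with rfl | hu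
      · exact ⟨D.src a, hs, Relation.ReflTransGen.head ⟨a, by simp, rfl, rfl⟩ p'⟩
      · exact ⟨u, hu, p'⟩
    · have : S \ insert a B = S.erase a \ B := by
        ext b; simp only [Finset.mem_sdiff, Finset.mem_insert, Finset.mem_erase]; tauto
      rwa [this]

/-- Edmonds' disjoint branchings theorem for two branchings with prescribed root sets. -/
theorem CutCondition.exists_disjoint_branchings {D : ArcDigraph V A} {W : Finset V} {S : Finset A}
    {R₁ R₂ : Finset V} (h : D.CutCondition W S R₁ R₂) (hS : ∀ a ∈ S, D.src a ∈ W)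
    (h₁ : R₁ ⊆ W) (h₂ : R₂ ⊆ W) :
    ∃ B₁ ⊆ S, ∃ B₂ ⊆ S, Disjoint B₁ B₂ ∧
      B₁.card + R₁.card = W.card ∧ B₂.card + R₂.card = W.card ∧
      (∀ w ∈ W, ∃ u ∈ R₁, D.HasPath B₁ u w) ∧ (∀ w ∈ W, ∃ u ∈ R₂, D.HasPath B₂ u w) := by
  obtain ⟨B₁, hB₁, c₁, p₁, h'⟩ := h.exists_branching hS h₁
  obtain ⟨B₂, hB₂, c₂, p₂, -⟩ :=
    h'.symm.exists_branching (fun a ha => hS a (Finset.mem_sdiff.1 ha).1) h₂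
  exact ⟨B₁, hB₁, B₂, hB₂.trans Finset.sdiff_subset,
    Finset.disjoint_of_subset_right hB₂ Finset.disjoint_sdiff, c₁, c₂, p₁, p₂⟩

end ArcDigraph

/-! ### Colouring the union of two matchings. -/

/-- The union of two matchings, given as involutions, has a proper two-colouring. -/
theorem exists_two_colouring_of_involutive {α : Type*} [Fintype α] [DecidableEq α] (p q : α → α)
    (hp : p.Involutive) (hq : q.Involutive) :
    ∃ c : α → Bool, ∀ x, (p x ≠ x → c (p x) ≠ c x) ∧ (q x ≠ x → c (q x) ≠ c x) := by
  induction hn : (Finset.univ.filter fun x => p x ≠ x).card using Nat.strong_induction_on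
    generalizing p q with
  | _ n ih =>
  by_cases hid : ∀ x, p x = x
  -- Only the matching `q` is left: an arbitrary linear order decides which partner gets which
  -- colour.
  · let e := Fintype.equivFin α
    refine ⟨fun x => decide (e x < e (q x)), fun x => ⟨fun h => absurd (hid x) h, fun h => ?_⟩⟩
    have hne : e (q x) ≠ e x := fun h' => h (e.injective h')
    simp only [hq x]
    rcases lt_or_gt_of_ne hne with h' | h' <;> simp [h', h'.le]
  · push Not at hid
    obtain ⟨a, hab⟩ := hid
    obtain ⟨b, hb⟩ : ∃ b, b = p a := ⟨_, rfl⟩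
    have hba : p b = a := by rw [hb, hp a]
    rw [← hb] at hab
    -- Contract the path through the `p`-edge `a b`: `a` and `b` become fixed, and their
    -- `q`-partners are matched with each other.
    let p' : α → α := fun z => if z = a ∨ z = b then z else p z
    let q' : α → α := fun z =>
      if z = a ∨ z = b then z
      else if q z = a then (if q b = b then z else q b)
      else if q z = b then (if q a = a then z else q a)
      else q z
    have hp' : p'.Involutive := fun z => by
      have := hp z
      simp only [p']; grind
    have hq' : q'.Involutive := fun z => by
      have h1 := hq z
      have h2 := hq a
      have h3 := hq b
      simp only [q']; grind
    have hlt : (Finset.univ.filter fun x => p' x ≠ x).card < n := by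
      rw [← hn]
      apply Finset.card_lt_card
      rw [Finset.ssubset_iff_of_subset]
      · exact ⟨a, by simp [← hb, hab], by simp [p']⟩
      · intro x; simp only [p', Finset.mem_filter, Finset.mem_univ, true_and]; grind
    obtain ⟨c, hc⟩ := ih _ hlt p' q' hp' hq' rfl
    have hcp : ∀ x, x ≠ a → x ≠ b → p x ≠ x → c (p x) ≠ c x := fun x h1 h2 h3 => by
      have := (hc x).1; simp only [p'] at this; grind
    have hqa : q a ≠ a → q a ≠ b → q b ≠ b → c (q b) ≠ c (q a) := fun h1 h2 h3 => by
      have := (hc (q a)).2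
      have h4 := hq a
      have h5 := hq b
      simp only [q'] at this; grind
    have hqx : ∀ x, x ≠ a → x ≠ b → q x ≠ a → q x ≠ b → q x ≠ x → c (q x) ≠ c x :=
      fun x h1 h2 h3 h4 h5 => by
        have := (hc x).2
        simpa only [q', h1, h2, h3, h4, or_self, if_false, h5, ne_eq, not_false_eq_true,
          forall_const] using this
    -- `u` colours `a` and `!u` colours `b`. Both `q`-edges can be satisfied because the contracted
    -- edge gave `q a` and `q b` different colours.
    obtain ⟨u, hua, hub⟩ : ∃ u : Bool, (q a ≠ a → q a ≠ b → u ≠ c (q a)) ∧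
        (q b ≠ b → q b ≠ a → u = c (q b)) := by
      by_cases h1 : q a ≠ a ∧ q a ≠ b
      · refine ⟨!c (q a), by simp, fun h2 _ => ?_⟩
        have := hqa h1.1 h1.2 h2
        cases h : c (q a) <;> cases h' : c (q b) <;> simp_all
      · exact ⟨c (q b), by tauto, by tauto⟩
    clear_value p' q'
    clear hqa hc
    have hqa := hq a
    have hqb := hq b
    refine ⟨fun z => if z = a then u else if z = b then !u else c z, fun x => ?_⟩
    have h1 := hq x
    have h4 := hp x
    have hx := hcp x
    have hqx := hqx x
    by_cases hxa : x = a
    · subst hxa; constructor <;> grind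
    by_cases hxb : x = b
    · subst hxb; constructor <;> grind
    constructor
    · grind
    · by_cases h5 : q x = a
      · have : q a = x := by rw [← h5, h1]
        have := hua (by grind) (by grind)
        simp only [h5, hxa, hxb, if_true, if_false]; grind
      · by_cases h6 : q x = b
        · have : q b = x := by rw [← h6, h1]
          have := hub (by grind) (by grind)
          simp only [h6, hxa, hxb, if_true, if_false]; grind
        · simp only [h5, h6, hxa, hxb, if_false]; grind

/-- A finite set with a labelling `g` refining a two-class labelling `h` can be paired up so that
partners are in the same `h`-class, at most one element of each `h`-class is single, and every
`g`-class with at least two elements contains a pair. -/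
theorem exists_pairing {α β : Type*} [DecidableEq α] (S : Finset α) (g : α → β)
    (h : α → Bool) (hgh : ∀ x y, g x = g y → h x = h y) :
    ∃ p : α → α, p.Involutive ∧ (∀ x ∉ S, p x = x) ∧ (∀ x, h (p x) = h x) ∧
      (∀ x ∈ S, ∀ y ∈ S, h x = h y → p x = x → p y = y → x = y) ∧
      (∀ x ∈ S, ∀ y ∈ S, x ≠ y → g x = g y → ∃ z ∈ S, g z = g x ∧ p z ≠ z ∧ g (p z) = g x) := by
  classical
  induction hn : S.card using Nat.strong_induction_on generalizing S with
  | _ n ih =>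
  -- Greedy pairing: one pair is removed and the rest handled by induction. Pairs with equal `g`
  -- take precedence; pairs with merely equal `h` are formed only once `g` is injective on `S`.
  have step : ∀ x ∈ S, ∀ y ∈ S, x ≠ y → h x = h y →
      (g x = g y ∨ ∀ z ∈ S, ∀ w ∈ S, g z = g w → z = w) →
      ∃ p : α → α, p.Involutive ∧ (∀ x ∉ S, p x = x) ∧ (∀ x, h (p x) = h x) ∧
        (∀ x ∈ S, ∀ y ∈ S, h x = h y → p x = x → p y = y → x = y) ∧
        (∀ x ∈ S, ∀ y ∈ S, x ≠ y → g x = g y →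
          ∃ z ∈ S, g z = g x ∧ p z ≠ z ∧ g (p z) = g x) := by
    intro x hx y hy hxy hh hg
    have hlt : ((S.erase x).erase y).card < n := by
      rw [← hn]
      exact (Finset.card_le_card (Finset.erase_subset _ _)).trans_lt
        (Finset.card_lt_card (Finset.erase_ssubset hx))
    obtain ⟨p, hp, hpS, hph, hps, hpg⟩ := ih _ hlt ((S.erase x).erase y) rfl
    simp only [Finset.mem_erase] at hpS hps hpg
    have hpx : p x = x := hpS x (by simp)
    have hpy : p y = y := hpS y (by simp)
    refine ⟨fun z => if z = x then y else if z = y then x else p z, fun z => ?_, fun z hz => ?_,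
      fun z => ?_, fun z hz w hw => ?_, fun z hz w hw hzw hgzw => ?_⟩
    · have := hp z
      grind
    · have := hpS z
      grind
    · have := hph z
      grind
    · have := hps z
      grind
    · rcases hg with hg | hg
      · by_cases hxz : g x = g z
        · exact ⟨x, hx, hxz, by simp [hxy.symm], by simp [← hg, hxz]⟩
        · obtain ⟨t, ht, h1, h2, h3⟩ := hpg z ⟨by grind, by grind, hz⟩ w ⟨by grind, by grind, hw⟩
            hzw hgzw
          refine ⟨t, ht.2.2, h1, ?_, ?_⟩ <;> simpa [ht.1, ht.2.1]
      · exact absurd (hg z hz w hw hgzw) hzw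
  by_cases h1 : ∀ z ∈ S, ∀ w ∈ S, g z = g w → z = w
  · by_cases h2 : ∀ z ∈ S, ∀ w ∈ S, h z = h w → z = w
    · exact ⟨id, fun _ => rfl, fun _ _ => rfl, fun _ => rfl, fun x hx y hy hh _ _ => h2 x hx y hy hh,
        fun x hx y hy hxy hg => absurd (h1 x hx y hy hg) hxy⟩
    · push Not at h2
      obtain ⟨x, hx, y, hy, hh, hxy⟩ := h2
      exact step x hx y hy hxy hh (Or.inr h1)
  · push Not at h1
    obtain ⟨x, hx, y, hy, hg, hxy⟩ := h1
    exact step x hx y hy hxy (hgh x y hg) (Or.inl hg)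

/-! ### Balanced colourings that split two labellings. -/

/-- The sign of a colour. -/
def colourSign (b : Bool) : ℤ := if b then 1 else -1

theorem abs_colourSign (b : Bool) : |colourSign b| = 1 := by cases b <;> simp [colourSign]

theorem colourSign_add_of_ne {a b : Bool} (h : a ≠ b) : colourSign b + colourSign a = 0 := by
  cases a <;> cases b <;> simp_all [colourSign]

theorem sum_colourSign_eq {α : Type*} (S : Finset α) (c : α → Bool) :
    ∑ x ∈ S, colourSign (c x) =
      ((S.filter fun x => c x = true).card : ℤ) - (S.filter fun x => c x = false).card := by
  rw [← Finset.sum_filter_add_sum_filter_not S (fun x => c x = true)]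
  simp only [Bool.not_eq_true]
  rw [Finset.sum_congr rfl (g := fun _ => (1 : ℤ)) (by simp +contextual [colourSign]),
    Finset.sum_congr (s₁ := S.filter fun x => c x = false) rfl (g := fun _ => (-1 : ℤ))
      (by simp +contextual [colourSign])]
  simp; ring

theorem sum_colourSign_mod_two {α : Type*} (S : Finset α) (c : α → Bool) :
    ∃ m : ℤ, ∑ x ∈ S, colourSign (c x) = S.card + 2 * m := by
  refine ⟨-(S.filter fun x => c x = false).card, ?_⟩
  rw [sum_colourSign_eq, ← Finset.card_filter_add_card_filter_not (s := S) (fun x => c x = true)]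
  simp only [Bool.not_eq_true]
  push_cast; ring

/-- Partners cancel, and at most one element has no partner. -/
theorem abs_sum_colourSign_le_one_of_involutive {α : Type*} [DecidableEq α] {S : Finset α}
    {c : α → Bool} {p : α → α} (hp : p.Involutive) (hpS : ∀ x ∈ S, p x ∈ S)
    (hps : ∀ x ∈ S, ∀ y ∈ S, p x = x → p y = y → x = y)
    (hc : ∀ x, p x ≠ x → c (p x) ≠ c x) : |∑ x ∈ S, colourSign (c x)| ≤ 1 := by
  rw [← Finset.sum_filter_add_sum_filter_not S (fun x => p x = x)]
  have h0 : ∑ x ∈ S.filter (fun x => ¬ p x = x), colourSign (c x) = 0 := by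
    refine Finset.sum_involution (fun x _ => p x) ?_ ?_ ?_ ?_
    · intro x hx; exact colourSign_add_of_ne (hc x (Finset.mem_filter.1 hx).2)
    · intro x hx _; exact (Finset.mem_filter.1 hx).2
    · intro x hx
      rw [Finset.mem_filter] at hx ⊢
      exact ⟨hpS x hx.1, fun h => hx.2 (hp.injective h)⟩
    · intro x _; exact hp x
  rw [h0, add_zero]
  refine (Finset.abs_sum_le_sum_abs _ _).trans ?_
  simp only [abs_colourSign, Finset.sum_const, nsmul_eq_mul, mul_one]
  norm_cast
  rw [Finset.card_le_one]
  intro x hx y hy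
  rw [Finset.mem_filter] at hx hy
  exact hps x hx.1 y hy.1 hx.2 hy.2

/-- A labelling on `S` is split by the colouring `c` if every label carried by at least two
elements occurs with both colours. -/
def SplitsLabels {α β : Type*} (S : Finset α) (g : α → β) (c : α → Bool) : Prop :=
  ∀ x ∈ S, ∀ y ∈ S, x ≠ y → g x = g y → ∀ i, ∃ z ∈ S, g z = g x ∧ c z = i

theorem Function.Involutive.mem_of_forall_notMem {α : Type*} {S : Finset α} {p : α → α}
    (hp : p.Involutive) (hpS : ∀ x ∉ S, p x = x) : ∀ x ∈ S, p x ∈ S := by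
  intro x hx
  by_contra hh
  have := hpS _ hh
  rw [hp x] at this
  exact hh (this ▸ hx)

theorem SplitsLabels.of_involutive {α β : Type*} {S : Finset α} {g : α → β} {c : α → Bool}
    {p : α → α} (hp : p.Involutive) (hpS : ∀ x ∉ S, p x = x) (hc : ∀ x, p x ≠ x → c (p x) ≠ c x)
    (hpg : ∀ x ∈ S, ∀ y ∈ S, x ≠ y → g x = g y →
      ∃ z ∈ S, g z = g x ∧ p z ≠ z ∧ g (p z) = g x) :
    SplitsLabels S g c := by
  intro x hx y hy hxy hg i
  obtain ⟨z, hz, h1, h2, h3⟩ := hpg x hx y hy hxy hg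
  have := hc z h2
  by_cases hi : c z = i
  · exact ⟨z, hz, h1, hi⟩
  · exact ⟨p z, hp.mem_of_forall_notMem hpS z hz, h3, by
      revert this hi; cases c z <;> cases c (p z) <;> cases i <;> simp⟩

theorem exists_colouring_balanced_on_classes {α β γ : Type*} [Fintype α] [DecidableEq α]
    (S : Finset α) (gl : α → β) (gr : α → γ) (l r : α → Bool)
    (hl : ∀ x y, gl x = gl y → l x = l y) (hr : ∀ x y, gr x = gr y → r x = r y) :
    ∃ c : α → Bool, SplitsLabels S gl c ∧ SplitsLabels S gr c ∧
      (∀ i, |∑ x ∈ S with l x = i, colourSign (c x)| ≤ 1) ∧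
      (∀ i, |∑ x ∈ S with r x = i, colourSign (c x)| ≤ 1) := by
  obtain ⟨p, hp, hpS, hpl, hps, hpg⟩ := exists_pairing S gl l hl
  obtain ⟨q, hq, hqS, hqr, hqs, hqg⟩ := exists_pairing S gr r hr
  obtain ⟨c, hc⟩ := exists_two_colouring_of_involutive p q hp hq
  refine ⟨c, SplitsLabels.of_involutive hp hpS (fun x => (hc x).1) hpg, SplitsLabels.of_involutive hq hqS (fun x => (hc x).2) hqg,
    fun i => ?_, fun i => ?_⟩
  · refine abs_sum_colourSign_le_one_of_involutive hp ?_ ?_ fun x => (hc x).1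
    · intro x hx
      rw [Finset.mem_filter] at hx ⊢
      exact ⟨hp.mem_of_forall_notMem hpS x hx.1, (hpl x).trans hx.2⟩
    · intro x hx y hy
      rw [Finset.mem_filter] at hx hy
      exact hps x hx.1 y hy.1 (hx.2.trans hy.2.symm)
  · refine abs_sum_colourSign_le_one_of_involutive hq ?_ ?_ fun x => (hc x).2
    · intro x hx
      rw [Finset.mem_filter] at hx ⊢
      exact ⟨hq.mem_of_forall_notMem hqS x hx.1, (hqr x).trans hx.2⟩
    · intro x hx y hy
      rw [Finset.mem_filter] at hx hy
      exact hqs x hx.1 y hy.1 (hx.2.trans hy.2.symm)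

theorem SplitsLabels.of_insertNone {α β : Type*} {S : Finset α} {g : α → β} {c : Option α → Bool}
    (h : SplitsLabels (Finset.insertNone S) (Option.map g) c) :
    SplitsLabels S g fun x => c (some x) := by
  intro x hx y hy hxy hg i
  obtain ⟨z, hz, h1, h2⟩ := h (some x) (by simpa) (some y) (by simpa) (by simpa) (by simpa) i
  cases z with
  | none => simp at h1
  | some z => exact ⟨z, by simpa using hz, by simpa using h1, h2⟩

theorem sum_filter_insertNone {α : Type*} (S : Finset α) (P : Option α → Prop) [DecidablePred P]
    (f : Option α → ℤ) :
    ∑ x ∈ Finset.insertNone S with P x, f x =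
      (if P none then f none else 0) + ∑ x ∈ S with P (some x), f (some x) := by
  rw [Finset.sum_filter, Finset.sum_filter, Finset.sum_insertNone]

/-- The two sums in the last bound lie in `{-1, 0, 1}` and have the parities of their classes. If
one class is even, its sum is 0 and the bound is immediate. If both are odd, a dummy element `none`
is added to both classes; they become even with sum 0, so both original sums equal minus the sign of
the dummy. Its label is shared with nobody, so splitting is unaffected. -/
theorem exists_balanced_colouring {α β γ : Type*} [Fintype α] [DecidableEq α]
    (S : Finset α) (gl : α → β) (gr : α → γ) (l r : α → Bool)
    (hl : ∀ x y, gl x = gl y → l x = l y) (hr : ∀ x y, gr x = gr y → r x = r y) :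
    ∃ c : α → Bool, SplitsLabels S gl c ∧ SplitsLabels S gr c ∧
      (∀ i, |∑ x ∈ S with l x = i, colourSign (c x)| ≤ 1) ∧
      (∀ i, |∑ x ∈ S with r x = i, colourSign (c x)| ≤ 1) ∧
      |∑ x ∈ S with l x = true, colourSign (c x) - ∑ x ∈ S with r x = false, colourSign (c x)|
        ≤ 1 := by
  by_cases hodd : Odd (S.filter fun x => l x = true).card ∧ Odd (S.filter fun x => r x = false).card
  · obtain ⟨c, h1, h2, h3, h4⟩ := exists_colouring_balanced_on_classes (Finset.insertNone S)
      (Option.map gl) (Option.map gr) (fun o => o.elim true l) (fun o => o.elim false r)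
      (by
        rintro (_ | x) (_ | y) <;> simp
        exact hl x y)
      (by
        rintro (_ | x) (_ | y) <;> simp
        exact hr x y)
    obtain ⟨⟨k, hk⟩, ⟨k', hk'⟩⟩ := hodd
    obtain ⟨m, hm⟩ := sum_colourSign_mod_two (S.filter fun x => l x = true) fun x => c (some x)
    obtain ⟨m', hm'⟩ := sum_colourSign_mod_two (S.filter fun x => r x = false) fun x => c (some x)
    have a1 := h3 true
    have a2 := h3 false
    have a3 := h4 true
    have a4 := h4 false
    have hs : colourSign (c none) = 1 ∨ colourSign (c none) = -1 := by
      cases c none <;> simp [colourSign]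
    rw [sum_filter_insertNone] at a1 a2 a3 a4
    simp only [Option.elim, if_true, Bool.true_eq_false, Bool.false_eq_true, if_false, zero_add] at a1 a2 a3 a4
    replace a1 : |colourSign (c none) + ∑ x ∈ S with l x = true, colourSign (c (some x))| ≤ 1 := a1
    replace a4 : |colourSign (c none) + ∑ x ∈ S with r x = false, colourSign (c (some x))| ≤ 1 := a4
    rw [abs_le] at a1 a4
    rw [hk] at hm
    rw [hk'] at hm'
    push_cast at hm hm'
    refine ⟨fun x => c (some x), h1.of_insertNone, h2.of_insertNone, ?_, ?_, ?_⟩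
    · rintro (_ | _)
      · exact a2
      · beta_reduce; rw [abs_le]; omega
    · rintro (_ | _)
      · beta_reduce; rw [abs_le]; omega
      · exact a3
    · beta_reduce; rw [abs_le]; omega
  · obtain ⟨c, h1, h2, h3, h4⟩ := exists_colouring_balanced_on_classes S gl gr l r hl hr
    refine ⟨c, h1, h2, h3, h4, ?_⟩
    obtain ⟨m, hm⟩ := sum_colourSign_mod_two (S.filter fun x => l x = true) c
    obtain ⟨m', hm'⟩ := sum_colourSign_mod_two (S.filter fun x => r x = false) c
    have a1 := abs_le.1 (h3 true)
    have a2 := abs_le.1 (h4 false)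
    rw [not_and_or, Nat.not_odd_iff_even, Nat.not_odd_iff_even] at hodd
    rw [abs_le]
    rcases hodd with ⟨k, hk⟩ | ⟨k, hk⟩
    · rw [hk] at hm; push_cast at hm; omega
    · rw [hk] at hm'; push_cast at hm'; omega

/-! ### Head labels and the cut condition. -/

namespace ArcDigraph

set_option linter.unusedSectionVars false

variable {V A : Type*} [Fintype V] [DecidableEq V] [Fintype A] [DecidableEq A]

/-- The smallest vertex set that contains `v` and that no arc of `T` enters. -/
def inClosure (D : ArcDigraph V A) (T : Finset A) (v : V) : Finset V :=
  Finset.univ.filter fun u => ∀ X : Finset V, D.inArcs T X = ∅ → v ∈ X → u ∈ X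

theorem mem_inClosure {D : ArcDigraph V A} {T : Finset A} {u v : V} :
    u ∈ D.inClosure T v ↔ ∀ X : Finset V, D.inArcs T X = ∅ → v ∈ X → u ∈ X := by
  simp [inClosure]

theorem self_mem_inClosure (D : ArcDigraph V A) (T : Finset A) (v : V) : v ∈ D.inClosure T v :=
  mem_inClosure.2 fun _ _ h => h

theorem inClosure_subset {D : ArcDigraph V A} {T : Finset A} {v : V} {X : Finset V}
    (hX : D.inArcs T X = ∅) (hv : v ∈ X) : D.inClosure T v ⊆ X :=
  fun _ hu => mem_inClosure.1 hu X hX hv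

theorem inArcs_inClosure (D : ArcDigraph V A) (T : Finset A) (v : V) :
    D.inArcs T (D.inClosure T v) = ∅ := by
  rw [Finset.eq_empty_iff_forall_notMem]
  intro a ha
  obtain ⟨haT, hs, ht⟩ := mem_inArcs.1 ha
  rw [mem_inClosure] at hs
  push Not at hs
  obtain ⟨X, hX, hv, hsX⟩ := hs
  have : a ∈ D.inArcs T X := mem_inArcs.2 ⟨haT, hsX, mem_inClosure.1 ht X hX hv⟩
  simp [hX] at this

/-- The label of an arc at its head: the head itself if it is shared with another arc of `M`, and
otherwise the in-closure of the head. The second component records which case occurs. -/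
def headLabel (D : ArcDigraph V A) (T M : Finset A) (a : A) : Finset V × Bool :=
  if 2 ≤ (M.filter fun b => D.tgt b = D.tgt a).card then ({D.tgt a}, true)
  else (D.inClosure T (D.tgt a), false)

theorem headLabel_congr (D : ArcDigraph V A) (T M : Finset A) {a b : A} (h : D.tgt a = D.tgt b) :
    D.headLabel T M a = D.headLabel T M b := by
  simp [headLabel, h]

theorem headLabel_snd_eq_false {D : ArcDigraph V A} {T M : Finset A} {a : A}
    (h : (D.headLabel T M a).2 = false) : (M.filter fun b => D.tgt b = D.tgt a).card ≤ 1 := by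
  unfold headLabel at h
  split_ifs at h
  omega

/-- The heads of the arcs of `M` of colour `i`. -/
def colourHeads (D : ArcDigraph V A) (M : Finset A) (c : A → Bool) (i : Bool) : Finset V :=
  (M.filter fun a => c a = i).image D.tgt

theorem mem_colourHeads {D : ArcDigraph V A} {M : Finset A} {c : A → Bool} {i : Bool} {v : V} :
    v ∈ D.colourHeads M c i ↔ ∃ a ∈ M, c a = i ∧ D.tgt a = v := by
  simp [colourHeads, and_assoc]

theorem exists_tgt_eq_of_splitsLabels {D : ArcDigraph V A} {T M : Finset A} {c : A → Bool}
    (hc : SplitsLabels M (D.headLabel T M) c) {v : V}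
    (hv : 2 ≤ (M.filter fun b => D.tgt b = v).card) (i : Bool) :
    ∃ a ∈ M, c a = i ∧ D.tgt a = v := by
  obtain ⟨x, hx, y, hy, hxy⟩ := Finset.one_lt_card.1 hv
  rw [Finset.mem_filter] at hx hy
  obtain ⟨z, hz, h1, h2⟩ := hc x hx.1 y hy.1 hxy (D.headLabel_congr T M (hx.2.trans hy.2.symm)) i
  refine ⟨z, hz, h2, ?_⟩
  unfold headLabel at h1
  rw [hx.2, if_pos hv] at h1
  split_ifs at h1 with h3
  · simpa using h1
  · simp at h1

/-- Only sets `X` entered by no arc of `T` are delicate: both colours must occur among the heads in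
`X`. With one entering arc, any single head in `X` suffices; with two, nothing is needed. -/
theorem cutCondition_of_splitsLabels {D : ArcDigraph V A} {W : Finset V} {T M : Finset A}
    (hcut : ∀ X ⊆ W, X.Nonempty →
      2 ≤ (D.inArcs T X).card + (M.filter fun a => D.tgt a ∈ X).card)
    {c : A → Bool} (hc : SplitsLabels M (D.headLabel T M) c) :
    D.CutCondition W T (D.colourHeads M c true) (D.colourHeads M c false) := by
  intro X hX hn
  have hcX := hcut X hX hn
  have hit : ∀ {i} {a : A}, a ∈ M → c a = i → D.tgt a ∈ X →
      ¬ Disjoint (D.colourHeads M c i) X := fun ha hi haX hd =>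
    Finset.disjoint_left.1 hd (mem_colourHeads.2 ⟨_, ha, hi, rfl⟩) haX
  have h0or : (D.inArcs T X).card = 0 ∨ (D.inArcs T X).card = 1 ∨ 2 ≤ (D.inArcs T X).card := by
    omega
  rcases h0or with h0 | h0 | h0
  -- A minimal in-closure `K` inside `X` is the in-closure of each of its vertices. At least two
  -- arcs of `M` have heads in `K`: either one of these heads is shared, or the two arcs carry the
  -- common label `(K, false)`. Splitting gives both colours in either case.
  · obtain ⟨v, hv, hmin⟩ := Finset.exists_min_image X (fun v => (D.inClosure T v).card) hn
    have hX0 := Finset.card_eq_zero.1 h0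
    have hKX : D.inClosure T v ⊆ X := inClosure_subset hX0 hv
    have hK : ∀ w ∈ D.inClosure T v, D.inClosure T w = D.inClosure T v := fun w hw =>
      Finset.eq_of_subset_of_card_le (inClosure_subset (D.inArcs_inClosure T v) hw)
        (hmin w (hKX hw))
    have hcK := hcut _ (hKX.trans hX) ⟨v, D.self_mem_inClosure T v⟩
    rw [D.inArcs_inClosure, Finset.card_empty, zero_add] at hcK
    obtain ⟨x, hx, y, hy, hxy⟩ := Finset.one_lt_card.1 hcK
    rw [Finset.mem_filter] at hx hy
    have both : ∀ i, ∃ a ∈ M, c a = i ∧ D.tgt a ∈ X := by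
      intro i
      by_cases hx2 : 2 ≤ (M.filter fun b => D.tgt b = D.tgt x).card
      · obtain ⟨a, ha, h1, h2⟩ := exists_tgt_eq_of_splitsLabels hc hx2 i
        exact ⟨a, ha, h1, h2 ▸ hKX hx.2⟩
      by_cases hy2 : 2 ≤ (M.filter fun b => D.tgt b = D.tgt y).card
      · obtain ⟨a, ha, h1, h2⟩ := exists_tgt_eq_of_splitsLabels hc hy2 i
        exact ⟨a, ha, h1, h2 ▸ hKX hy.2⟩
      have hlab : D.headLabel T M x = (D.inClosure T v, false) := by
        rw [headLabel, if_neg hx2, hK _ hx.2]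
      have hlab' : D.headLabel T M y = (D.inClosure T v, false) := by
        rw [headLabel, if_neg hy2, hK _ hy.2]
      obtain ⟨z, hz, h1, h2⟩ := hc x hx.1 y hy.1 hxy (hlab.trans hlab'.symm) i
      refine ⟨z, hz, h2, hKX ?_⟩
      rw [hlab, headLabel] at h1
      split_ifs at h1
      · simp at h1
      · rw [show D.inClosure T v = D.inClosure T (D.tgt z) from (congrArg Prod.fst h1).symm]
        exact D.self_mem_inClosure T _
    obtain ⟨a, ha, h1, h2⟩ := both true
    obtain ⟨b, hb, h3, h4⟩ := both false
    rw [if_neg (hit ha h1 h2), if_neg (hit hb h3 h4)]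
    exact Nat.zero_le _
  · obtain ⟨a, ha⟩ := Finset.card_pos.1 (show 0 < (M.filter fun a => D.tgt a ∈ X).card by omega)
    rw [Finset.mem_filter] at ha
    cases h : c a
    · rw [if_neg (hit ha.1 h ha.2)]
      split_ifs <;> omega
    · rw [if_neg (hit ha.1 h ha.2)]
      split_ifs <;> omega
  · refine le_trans ?_ h0
    split_ifs <;> omega

/-- A shared head occurs in both colours and so cancels in the difference of the two root set sizes;
arcs with unshared heads are counted injectively. -/
theorem card_colourHeads {D : ArcDigraph V A} {T M : Finset A} {c : A → Bool}
    (hc : SplitsLabels M (D.headLabel T M) c) (i : Bool) :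
    (D.colourHeads M c i).card =
      (Finset.univ.filter fun v => 2 ≤ (M.filter fun b => D.tgt b = v).card).card +
      ((M.filter fun a => (D.headLabel T M a).2 = false).filter fun a => c a = i).card := by
  set N := (M.filter fun a => (D.headLabel T M a).2 = false).filter fun a => c a = i with hN
  have hmem : ∀ a, a ∈ N → a ∈ M ∧ c a = i ∧ (M.filter fun b => D.tgt b = D.tgt a).card ≤ 1 := by
    intro a ha
    simp only [hN, Finset.mem_filter] at ha
    exact ⟨ha.1.1, ha.2, headLabel_snd_eq_false ha.1.2⟩
  have hinj : Set.InjOn D.tgt N := by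
    intro a ha b hb hab
    exact Finset.card_le_one.1 (hmem a ha).2.2 a (by simp [(hmem a ha).1]) b
      (by simp [(hmem b hb).1, hab])
  rw [← Finset.card_image_of_injOn hinj, ← Finset.card_union_of_disjoint]
  · congr 1
    ext v
    simp only [mem_colourHeads, Finset.mem_union, Finset.mem_filter, Finset.mem_univ, true_and,
      Finset.mem_image]
    constructor
    · rintro ⟨a, ha, h1, rfl⟩
      by_cases h2 : 2 ≤ (M.filter fun b => D.tgt b = D.tgt a).card
      · exact Or.inl h2
      · refine Or.inr ⟨a, ?_, rfl⟩
        have hl : (D.headLabel T M a).2 = false := by rw [headLabel, if_neg h2]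
        simp only [hN, Finset.mem_filter]
        exact ⟨⟨ha, hl⟩, h1⟩
    · rintro (h | ⟨a, ha, rfl⟩)
      · exact exists_tgt_eq_of_splitsLabels hc h i
      · exact ⟨a, (hmem a ha).1, (hmem a ha).2.1, rfl⟩
  · rw [Finset.disjoint_left]
    intro v hv hv'
    obtain ⟨a, ha, rfl⟩ := Finset.mem_image.1 hv'
    have := (hmem a ha).2.2
    simp only [Finset.mem_filter, Finset.mem_univ, true_and] at hv
    omega

/-- A label-splitting colouring of the entering arcs `M` extends to two disjoint branchings
inside `W`, and the difference of their sizes is determined by the arcs with unshared head. -/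
theorem exists_disjoint_branchings_of_splitsLabels {D : ArcDigraph V A} {W : Finset V}
    {T M : Finset A} (hT : ∀ a ∈ T, D.src a ∈ W) (hM : ∀ a ∈ M, D.tgt a ∈ W)
    (hcut : ∀ X ⊆ W, X.Nonempty →
      2 ≤ (D.inArcs T X).card + (M.filter fun a => D.tgt a ∈ X).card)
    {c : A → Bool} (hc : SplitsLabels M (D.headLabel T M) c) :
    ∃ B : Bool → Finset A, (∀ i, B i ⊆ T) ∧ Disjoint (B true) (B false) ∧
      ((B true).card : ℤ) - (B false).card =
        - ∑ a ∈ M with (D.headLabel T M a).2 = false, colourSign (c a) ∧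
      ∀ i, ∀ w ∈ W, ∃ a ∈ M, c a = i ∧ D.HasPath (B i) (D.tgt a) w := by
  have hsub : ∀ i, D.colourHeads M c i ⊆ W := by
    intro i v hv
    obtain ⟨a, ha, -, rfl⟩ := mem_colourHeads.1 hv
    exact hM a ha
  obtain ⟨B₁, h₁, B₂, h₂, hd, c₁, c₂, p₁, p₂⟩ :=
    (cutCondition_of_splitsLabels hcut hc).exists_disjoint_branchings hT (hsub _) (hsub _)
  refine ⟨fun i => if i then B₁ else B₂, ?_, by simpa using hd, ?_, ?_⟩
  · rintro (_ | _) <;> simpa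
  · rw [sum_colourSign_eq]
    have e₁ := card_colourHeads hc true
    have e₂ := card_colourHeads hc false
    simp only [if_true, Bool.false_eq_true, if_false]
    omega
  · rintro (_ | _) w hw
    · obtain ⟨u, hu, p⟩ := p₂ w hw
      obtain ⟨a, ha, h, rfl⟩ := mem_colourHeads.1 hu
      exact ⟨a, ha, h, p⟩
    · obtain ⟨u, hu, p⟩ := p₁ w hw
      obtain ⟨a, ha, h, rfl⟩ := mem_colourHeads.1 hu
      exact ⟨a, ha, h, p⟩

/-! ### Exchanging two bibranchings. -/

theorem IsVertexPartition.reverse {D : ArcDigraph V A} {V₁ V₂ : Finset V}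
    (h : D.IsVertexPartition V₁ V₂) : D.reverse.IsVertexPartition V₂ V₁ :=
  ⟨h.disjoint.symm, by rw [Finset.union_comm]; exact h.cover,
    fun a ha => h.no_back_arc a ⟨ha.2, ha.1⟩⟩

theorem IsBibranching.reverse {D : ArcDigraph V A} {V₁ V₂ : Finset V} {F : Finset A}
    (h : D.IsBibranching V₁ V₂ F) : D.reverse.IsBibranching V₂ V₁ F := by
  refine ⟨fun v hv => ?_, fun v hv => ?_⟩
  · obtain ⟨u, hu, p⟩ := h.exists_path_from v hv
    exact ⟨u, hu, p.reverse⟩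
  · obtain ⟨u, hu, p⟩ := h.exists_path_to v hv
    exact ⟨u, hu, p.reverse⟩

theorem HasPath.exists_enters {D : ArcDigraph V A} {F : Finset A} {u v : V}
    (p : D.HasPath F u v) {X : Finset V} (hu : u ∉ X) (hv : v ∈ X) :
    ∃ a ∈ F, D.src a ∉ X ∧ D.tgt a ∈ X := by
  induction p with
  | refl => exact absurd hv hu
  | @tail y z _ e ih =>
    obtain ⟨a, ha, rfl, rfl⟩ := e
    by_cases hy : D.src a ∈ X
    · exact ih hy
    · exact ⟨a, ha, hy, hv⟩

theorem IsBibranching.exists_enters {D : ArcDigraph V A} {V₁ V₂ : Finset V} {F : Finset A}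
    (h : D.IsBibranching V₁ V₂ F) (hd : Disjoint V₁ V₂) {X : Finset V} (hX : X ⊆ V₂)
    (hn : X.Nonempty) : ∃ a ∈ F, D.src a ∉ X ∧ D.tgt a ∈ X := by
  obtain ⟨v, hv⟩ := hn
  obtain ⟨u, hu, p⟩ := h.exists_path_from v (hX hv)
  exact p.exists_enters (fun hh => Finset.disjoint_left.1 hd hu (hX hh)) hv

theorem IsVertexPartition.mem_or {D : ArcDigraph V A} {V₁ V₂ : Finset V}
    (h : D.IsVertexPartition V₁ V₂) (v : V) : v ∈ V₁ ∨ v ∈ V₂ := by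
  have := Finset.mem_univ v
  rwa [← h.cover, Finset.mem_union] at this

/-- The arcs of `U` with both ends in `W`. -/
def arcsInside (D : ArcDigraph V A) (U : Finset A) (W : Finset V) : Finset A :=
  U.filter fun a => D.src a ∈ W ∧ D.tgt a ∈ W

theorem mem_arcsInside {D : ArcDigraph V A} {U : Finset A} {W : Finset V} {a : A} :
    a ∈ D.arcsInside U W ↔ a ∈ U ∧ D.src a ∈ W ∧ D.tgt a ∈ W := by
  simp [arcsInside]

theorem mem_delta {D : ArcDigraph V A} {V₁ V₂ : Finset V} {a : A} :
    a ∈ D.delta V₁ V₂ ↔ D.src a ∈ V₁ ∧ D.tgt a ∈ V₂ := by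
  simp [delta]

theorem reverse_delta (D : ArcDigraph V A) (V₁ V₂ : Finset V) :
    D.reverse.delta V₂ V₁ = D.delta V₁ V₂ := by
  ext a
  simp only [mem_delta, ArcDigraph.reverse, and_comm]

/-- Each bibranching has its own arc entering `X`, whose tail lies in `V₂` or in `V₁`; these are the
two kinds of arcs counted. -/
theorem IsVertexPartition.two_le_card_cut {D : ArcDigraph V A} {V₁ V₂ : Finset V}
    (hD : D.IsVertexPartition V₁ V₂) {F₁ F₂ : Finset A} (hd : Disjoint F₁ F₂)
    (h₁ : D.IsBibranching V₁ V₂ F₁) (h₂ : D.IsBibranching V₁ V₂ F₂) :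
    ∀ X ⊆ V₂, X.Nonempty → 2 ≤ (D.inArcs (D.arcsInside (F₁ ∪ F₂) V₂) X).card +
      (((F₁ ∪ F₂) ∩ D.delta V₁ V₂).filter fun a => D.tgt a ∈ X).card := by
  intro X hX hn
  refine le_trans ?_ (Finset.card_union_le _ _)
  have key : ∀ a ∈ F₁ ∪ F₂, D.src a ∉ X → D.tgt a ∈ X →
      a ∈ D.inArcs (D.arcsInside (F₁ ∪ F₂) V₂) X ∪
        ((F₁ ∪ F₂) ∩ D.delta V₁ V₂).filter fun a => D.tgt a ∈ X := by
    intro a ha hs ht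
    rw [Finset.mem_union, mem_inArcs, mem_arcsInside, Finset.mem_filter, Finset.mem_inter,
      mem_delta]
    have := hX ht
    rcases hD.mem_or (D.src a) with h | h <;> tauto
  obtain ⟨a, ha, h3, h4⟩ := h₁.exists_enters hD.disjoint hX hn
  obtain ⟨b, hb, h5, h6⟩ := h₂.exists_enters hD.disjoint hX hn
  exact Finset.one_lt_card.2 ⟨a, key a (Finset.mem_union_left _ ha) h3 h4,
    b, key b (Finset.mem_union_right _ hb) h5 h6,
    fun hab => Finset.disjoint_left.1 hd ha (hab ▸ hb)⟩

theorem exists_subset_balancing {α : Type*} (E : Finset α) (n b : ℤ) (hn : |n| ≤ 2)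
    (hb : |b| ≤ 2) (hf : |n + b| ≤ 1) :
    ∃ E' ⊆ E, |n + b + (2 * (E'.card : ℤ) - E.card)| ≤ 1 ∧
      |b + (2 * (E'.card : ℤ) - E.card)| ≤ 2 := by
  rw [abs_le] at hn hb hf
  obtain ⟨k, hk, h⟩ : ∃ k ≤ E.card, |n + b + (2 * (k : ℤ) - E.card)| ≤ 1 ∧
      |b + (2 * (k : ℤ) - E.card)| ≤ 2 := by
    simp only [abs_le]
    rcases Nat.even_or_odd' E.card with ⟨m, hm | hm⟩
    · exact ⟨m, by omega, by omega⟩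
    -- An odd number of spare arcs forces a shift by 1: downwards when the total is 1, upwards when
    -- it is -1, and when it is 0 in the direction that does not enlarge `|b|` beyond 2.
    · by_cases hs : n + b = 1 ∨ (n + b = 0 ∧ 0 < b)
      · exact ⟨m, by omega, by omega⟩
      · exact ⟨m + 1, by omega, by omega⟩
  obtain ⟨E', hE', hc⟩ := Finset.exists_subset_card_eq hk
  exact ⟨E', hE', by rwa [hc]⟩

/-- Two disjoint bibranchings can be exchanged for two balanced ones with the same union. -/
theorem IsVertexPartition.exists_balanced_pair {D : ArcDigraph V A} {V₁ V₂ : Finset V}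
    (hD : D.IsVertexPartition V₁ V₂) {F₁ F₂ : Finset A} (hd : Disjoint F₁ F₂)
    (h₁ : D.IsBibranching V₁ V₂ F₁) (h₂ : D.IsBibranching V₁ V₂ F₂) :
    ∃ G₁ G₂ : Finset A, Disjoint G₁ G₂ ∧ G₁ ∪ G₂ = F₁ ∪ F₂ ∧
      D.IsBibranching V₁ V₂ G₁ ∧ D.IsBibranching V₁ V₂ G₂ ∧
      |(G₁.card : ℤ) - G₂.card| ≤ 1 ∧
      |((G₁ ∩ D.delta V₁ V₂).card : ℤ) - (G₂ ∩ D.delta V₁ V₂).card| ≤ 2 ∧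
      |((G₁ \ D.delta V₁ V₂).card : ℤ) - (G₂ \ D.delta V₁ V₂).card| ≤ 2 := by
  set U := F₁ ∪ F₂ with hU
  set M := U ∩ D.delta V₁ V₂ with hM
  set T₂ := D.arcsInside U V₂ with hT₂
  set T₁ := D.reverse.arcsInside U V₁ with hT₁
  have hcut₂ := hD.two_le_card_cut hd h₁ h₂
  have hcut₁ := hD.reverse.two_le_card_cut hd h₁.reverse h₂.reverse
  rw [reverse_delta, ← hU, ← hT₁, ← hM] at hcut₁
  rw [← hU, ← hT₂, ← hM] at hcut₂
  obtain ⟨c, hcl, hcr, hbl, hbr, hbf⟩ := exists_balanced_colouring M (D.reverse.headLabel T₁ M)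
    (D.headLabel T₂ M) (fun a => (D.reverse.headLabel T₁ M a).2) (fun a => (D.headLabel T₂ M a).2)
    (fun _ _ h => congrArg Prod.snd h) (fun _ _ h => congrArg Prod.snd h)
  have memM : ∀ a ∈ M, a ∈ U ∧ D.src a ∈ V₁ ∧ D.tgt a ∈ V₂ := fun a ha => by
    rwa [hM, Finset.mem_inter, mem_delta] at ha
  have memT₁ : ∀ a ∈ T₁, a ∈ U ∧ D.tgt a ∈ V₁ ∧ D.src a ∈ V₁ := fun a ha => mem_arcsInside.1 ha
  have memT₂ : ∀ a ∈ T₂, a ∈ U ∧ D.src a ∈ V₂ ∧ D.tgt a ∈ V₂ := fun a ha => mem_arcsInside.1 ha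
  obtain ⟨B₂, hB₂, hBd₂, hBc₂, hBp₂⟩ := exists_disjoint_branchings_of_splitsLabels
    (fun a ha => (memT₂ a ha).2.1) (fun a ha => (memM a ha).2.2) hcut₂ hcr
  obtain ⟨B₁, hB₁, hBd₁, hBc₁, hBp₁⟩ := exists_disjoint_branchings_of_splitsLabels
    (D := D.reverse) (fun a ha => (memT₁ a ha).2.1) (fun a ha => (memM a ha).2.1) hcut₁ hcl
  have disj : ∀ v, v ∈ V₁ → v ∉ V₂ := fun v hv => Finset.disjoint_left.1 hD.disjoint hv
  set N : Bool → Finset A := fun i => M.filter fun a => c a = i with hN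
  have hNM : ∀ i, N i ⊆ M := fun i => Finset.filter_subset _ _
  have hNd : Disjoint (N true) (N false) := by
    rw [Finset.disjoint_left]; intro a ha hb
    simp only [hN, Finset.mem_filter] at ha hb
    simp [ha.2] at hb
  have hNU : N true ∪ N false = M := by
    ext a; simp only [hN, Finset.mem_union, Finset.mem_filter]
    cases c a <;> simp
  set P : Bool → Finset A := fun i => B₁ i ∪ B₂ i with hP
  have hPmem : ∀ i, ∀ a ∈ P i, a ∈ U ∧ a ∉ D.delta V₁ V₂ := by
    intro i a ha
    rw [mem_delta]
    rcases Finset.mem_union.1 ha with ha | ha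
    · have := memT₁ a (hB₁ i ha)
      exact ⟨this.1, fun h => disj _ this.2.1 h.2⟩
    · have := memT₂ a (hB₂ i ha)
      exact ⟨this.1, fun h => disj _ h.1 this.2.1⟩
  have hTd : Disjoint T₁ T₂ := by
    rw [Finset.disjoint_left]; intro a ha hb
    exact disj _ (memT₁ a ha).2.1 (memT₂ a hb).2.2
  have hPd : Disjoint (P true) (P false) := by
    simp only [hP, Finset.disjoint_union_left, Finset.disjoint_union_right]
    exact ⟨⟨hBd₁, (Disjoint.mono (hB₁ _) (hB₂ _) hTd).symm⟩, ⟨Disjoint.mono (hB₁ _) (hB₂ _) hTd,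
      hBd₂⟩⟩
  have hPc : ∀ i, (P i).card = (B₁ i).card + (B₂ i).card := fun i =>
    Finset.card_union_of_disjoint (Disjoint.mono (hB₁ i) (hB₂ i) hTd)
  set E := (U \ M) \ (P true ∪ P false) with hE
  set n : ℤ := ∑ a ∈ M, colourSign (c a) with hn
  set b : ℤ := ((P true).card : ℤ) - (P false).card with hb
  have hnN : n = ((N true).card : ℤ) - (N false).card := sum_colourSign_eq M c
  have hsl := Finset.sum_filter_add_sum_filter_not M
    (fun a => (D.reverse.headLabel T₁ M a).2 = true) (fun a => colourSign (c a))
  simp only [Bool.not_eq_true] at hsl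
  have a1 := hbl true
  have a2 := hbl false
  have a3 := hbr false
  rw [abs_le] at a1 a2 a3 hbf
  -- Splitting `n` by tail label, the sum over unshared tails cancels in `n + b`. What remains is
  -- the sum over shared tails minus the sum over unshared heads, which is the difference bounded in
  -- `hbf`.
  have hbe : b = - (∑ a ∈ M with (D.reverse.headLabel T₁ M a).2 = false, colourSign (c a)) -
      ∑ a ∈ M with (D.headLabel T₂ M a).2 = false, colourSign (c a) := by
    rw [hb, hPc, hPc]; push_cast; linarith
  obtain ⟨E', hE', hf', hb'⟩ := exists_subset_balancing E n b (by rw [abs_le]; omega)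
    (by rw [abs_le]; omega) (by rw [abs_le]; omega)
  set R : Bool → Finset A := fun i => if i then E' else E \ E' with hR
  have hRE : ∀ i, R i ⊆ E := by
    rintro (_ | _)
    · exact Finset.sdiff_subset
    · exact hE'
  have hEmem : ∀ a ∈ E, a ∈ U ∧ a ∉ D.delta V₁ V₂ ∧ a ∉ P true ∧ a ∉ P false := by
    intro a ha
    simp only [hE, hM, Finset.mem_sdiff, Finset.mem_inter, Finset.mem_union] at ha
    tauto
  have hRP : ∀ i, Disjoint (P i) (R i) := by
    intro i
    rw [Finset.disjoint_left]; intro a ha hb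
    have := hEmem a (hRE i hb)
    cases i <;> tauto
  set G : Bool → Finset A := fun i => N i ∪ (P i ∪ R i) with hG
  have hGδ : ∀ i, G i ∩ D.delta V₁ V₂ = N i := by
    intro i; ext a
    simp only [hG, Finset.mem_inter, Finset.mem_union]
    constructor
    · rintro ⟨h | h | h, h'⟩
      · exact h
      · exact absurd h' (hPmem i a h).2
      · exact absurd h' (hEmem a (hRE i h)).2.1
    · intro h
      exact ⟨Or.inl h, (Finset.mem_inter.1 (hNM i h)).2⟩
  have hGB : ∀ i, G i \ D.delta V₁ V₂ = P i ∪ R i := by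
    intro i; ext a
    simp only [hG, Finset.mem_sdiff, Finset.mem_union]
    constructor
    · rintro ⟨h | h, h'⟩
      · exact absurd (Finset.mem_inter.1 (hNM i h)).2 h'
      · exact h
    · rintro (h | h)
      · exact ⟨Or.inr (Or.inl h), (hPmem i a h).2⟩
      · exact ⟨Or.inr (Or.inr h), (hEmem a (hRE i h)).2.1⟩
  have hGc : ∀ i, (G i).card = (N i).card + (P i ∪ R i).card := by
    intro i
    rw [← Finset.card_inter_add_card_sdiff (G i) (D.delta V₁ V₂), hGδ, hGB]
  have hBc : ∀ i, (P i ∪ R i).card = (P i).card + (R i).card := fun i =>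
    Finset.card_union_of_disjoint (hRP i)
  have hRd : ((R true).card : ℤ) - (R false).card = 2 * (E'.card : ℤ) - E.card := by
    simp only [hR, if_true, Bool.false_eq_true, if_false]
    have := Finset.card_sdiff_add_card_eq_card hE'
    omega
  have hGbib : ∀ i, D.IsBibranching V₁ V₂ (G i) := by
    intro i
    have hNG : ∀ a ∈ M, c a = i → a ∈ G i := fun a ha h =>
      Finset.mem_union_left _ (Finset.mem_filter.2 ⟨ha, h⟩)
    refine ⟨fun v hv => ?_, fun v hv => ?_⟩
    · obtain ⟨a, ha, h, p⟩ := hBp₁ i v hv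
      have hsub : B₁ i ⊆ G i := fun x hx => by simp [hG, hP, hx]
      exact ⟨D.tgt a, (memM a ha).2.2,
        Relation.ReflTransGen.tail (p.reverse.mono hsub) ⟨a, hNG a ha h, rfl, rfl⟩⟩
    · obtain ⟨a, ha, h, p⟩ := hBp₂ i v hv
      have hsub : B₂ i ⊆ G i := fun x hx => by simp [hG, hP, hx]
      exact ⟨D.src a, (memM a ha).2.1,
        Relation.ReflTransGen.head ⟨a, hNG a ha h, rfl, rfl⟩ (p.mono hsub)⟩
  refine ⟨G true, G false, ?_, ?_, hGbib true, hGbib false, ?_, ?_, ?_⟩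
  · rw [Finset.disjoint_left]; intro a ha hb
    by_cases hδ : a ∈ D.delta V₁ V₂
    · have h1 : a ∈ N true := hGδ true ▸ Finset.mem_inter.2 ⟨ha, hδ⟩
      have h2 : a ∈ N false := hGδ false ▸ Finset.mem_inter.2 ⟨hb, hδ⟩
      exact Finset.disjoint_left.1 hNd h1 h2
    · have h1 : a ∈ P true ∪ R true := hGB true ▸ Finset.mem_sdiff.2 ⟨ha, hδ⟩
      have h2 : a ∈ P false ∪ R false := hGB false ▸ Finset.mem_sdiff.2 ⟨hb, hδ⟩
      rw [Finset.mem_union] at h1 h2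
      rcases h1 with h1 | h1 <;> rcases h2 with h2 | h2
      · exact Finset.disjoint_left.1 hPd h1 h2
      · exact (hEmem a (hRE _ h2)).2.2.1 h1
      · exact (hEmem a (hRE _ h1)).2.2.2 h2
      · simp only [hR, if_true, Bool.false_eq_true, if_false, Finset.mem_sdiff] at h1 h2
        exact h2.2 h1
  · apply Finset.Subset.antisymm
    · intro a ha
      have : ∀ i, a ∈ G i → a ∈ U := by
        intro i h
        simp only [hG, Finset.mem_union] at h
        rcases h with h | h | h
        · exact (memM a (hNM i h)).1
        · exact (hPmem i a h).1
        · exact (hEmem a (hRE i h)).1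
      rcases Finset.mem_union.1 ha with h | h
      · exact this _ h
      · exact this _ h
    · intro a ha
      by_cases hMa : a ∈ M
      · rw [← hNU] at hMa
        simp only [hG, Finset.mem_union] at hMa ⊢
        tauto
      · by_cases hPa : a ∈ P true ∪ P false
        · simp only [hG, Finset.mem_union] at hPa ⊢
          tauto
        · have hEa : a ∈ E := Finset.mem_sdiff.2 ⟨Finset.mem_sdiff.2 ⟨ha, hMa⟩, hPa⟩
          by_cases h : a ∈ E'
          · simp [hG, hR, h]
          · simp [hG, hR, h, hEa]
  · rw [hGc, hGc, hBc, hBc]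
    rw [abs_le] at hf' ⊢
    push_cast
    omega
  · rw [hGδ, hGδ, ← hnN, abs_le]
    omega
  · rw [hGB, hGB, hBc, hBc]
    rw [abs_le] at hb' ⊢
    push_cast
    omega

/-! ### Minimising the total weight. -/

/-- The measure of imbalance that the exchange of two bibranchings decreases. -/
def weight (D : ArcDigraph V A) (V₁ V₂ : Finset V) (F : Finset A) : ℕ :=
  2 * F.card ^ 2 + (F ∩ D.delta V₁ V₂).card ^ 2 + (F \ D.delta V₁ V₂).card ^ 2

/-- The value 8 is attained at `(2, -2)`. The coefficient 2 of the total is needed to separate the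
cases: with coefficient 1, the unbalanced pair `(1, 1)` would give only 6. -/
theorem sum_sq_le_of_balanced {x y : ℤ} (hf : |x + y| ≤ 1) (hx : |x| ≤ 2) (hy : |y| ≤ 2) :
    2 * (x + y) ^ 2 + x ^ 2 + y ^ 2 ≤ 8 := by
  rw [abs_le] at *
  obtain ⟨h1, h2⟩ := hx
  obtain ⟨h3, h4⟩ := hy
  interval_cases x <;> interval_cases y <;> omega

theorem lt_sum_sq_of_unbalanced {x y : ℤ} (h : ¬ (|x + y| ≤ 1 ∧ |x| ≤ 2 ∧ |y| ≤ 2)) :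
    8 < 2 * (x + y) ^ 2 + x ^ 2 + y ^ 2 := by
  by_cases hf : |x + y| ≤ 1
  · have h' : 3 ≤ |x| ∧ 2 ≤ |y| ∨ 2 ≤ |x| ∧ 3 ≤ |y| := by
      simp only [abs_le, le_abs] at *; omega
    rw [← sq_abs x, ← sq_abs y]
    rcases h' with ⟨h1, h2⟩ | ⟨h1, h2⟩ <;> nlinarith [sq_nonneg (x + y)]
  · have h1 : 2 ≤ |x + y| := by omega
    have h2 : 4 ≤ (x + y) ^ 2 := by rw [← sq_abs]; nlinarith
    nlinarith [sq_nonneg (x - y)]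

theorem weight_add_weight_eq (D : ArcDigraph V A) (V₁ V₂ : Finset V) (F G : Finset A) :
    (2 * (D.weight V₁ V₂ F + D.weight V₁ V₂ G) : ℤ) =
      2 * ((F.card : ℤ) + G.card) ^ 2 +
      (((F ∩ D.delta V₁ V₂).card : ℤ) + (G ∩ D.delta V₁ V₂).card) ^ 2 +
      (((F \ D.delta V₁ V₂).card : ℤ) + (G \ D.delta V₁ V₂).card) ^ 2 +
      (2 * ((F.card : ℤ) - G.card) ^ 2 +
      (((F ∩ D.delta V₁ V₂).card : ℤ) - (G ∩ D.delta V₁ V₂).card) ^ 2 +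
      (((F \ D.delta V₁ V₂).card : ℤ) - (G \ D.delta V₁ V₂).card) ^ 2) := by
  simp only [weight]
  push_cast
  ring

/-- The three bounds on the sizes of two arc sets. -/
def Balanced (D : ArcDigraph V A) (V₁ V₂ : Finset V) (F G : Finset A) : Prop :=
  |(F.card : ℤ) - G.card| ≤ 1 ∧
    |((F ∩ D.delta V₁ V₂).card : ℤ) - (G ∩ D.delta V₁ V₂).card| ≤ 2 ∧
    |((F \ D.delta V₁ V₂).card : ℤ) - (G \ D.delta V₁ V₂).card| ≤ 2

theorem card_sub_card_eq (D : ArcDigraph V A) (V₁ V₂ : Finset V) (F G : Finset A) :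
    (F.card : ℤ) - G.card =
      (((F ∩ D.delta V₁ V₂).card : ℤ) - (G ∩ D.delta V₁ V₂).card) +
      (((F \ D.delta V₁ V₂).card : ℤ) - (G \ D.delta V₁ V₂).card) := by
  have h1 := Finset.card_inter_add_card_sdiff F (D.delta V₁ V₂)
  have h2 := Finset.card_inter_add_card_sdiff G (D.delta V₁ V₂)
  omega

theorem card_inter_add_of_union_eq {F₁ F₂ G₁ G₂ : Finset A} (hF : Disjoint F₁ F₂)
    (hG : Disjoint G₁ G₂) (h : G₁ ∪ G₂ = F₁ ∪ F₂) (S : Finset A) :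
    (G₁ ∩ S).card + (G₂ ∩ S).card = (F₁ ∩ S).card + (F₂ ∩ S).card := by
  rw [← Finset.card_union_of_disjoint (hG.mono Finset.inter_subset_left Finset.inter_subset_left),
    ← Finset.card_union_of_disjoint (hF.mono Finset.inter_subset_left Finset.inter_subset_left),
    ← Finset.union_inter_distrib_right, ← Finset.union_inter_distrib_right, h]

/-- By `2(a² + b²) = (a + b)² + (a - b)²`, and since the common union fixes all the sums, only the
squared differences change; the threshold 8 separates them. -/
theorem weight_add_weight_lt {D : ArcDigraph V A} {V₁ V₂ : Finset V} {F₁ F₂ G₁ G₂ : Finset A}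
    (hF : Disjoint F₁ F₂) (hG : Disjoint G₁ G₂) (h : G₁ ∪ G₂ = F₁ ∪ F₂)
    (hGb : D.Balanced V₁ V₂ G₁ G₂) (hFb : ¬ D.Balanced V₁ V₂ F₁ F₂) :
    D.weight V₁ V₂ G₁ + D.weight V₁ V₂ G₂ < D.weight V₁ V₂ F₁ + D.weight V₁ V₂ F₂ := by
  have eF := D.weight_add_weight_eq V₁ V₂ F₁ F₂
  have eG := D.weight_add_weight_eq V₁ V₂ G₁ G₂
  unfold Balanced at hGb hFb
  rw [D.card_sub_card_eq V₁ V₂] at hGb hFb eF eG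
  have l1 := sum_sq_le_of_balanced hGb.1 hGb.2.1 hGb.2.2
  have l2 := lt_sum_sq_of_unbalanced hFb
  have s1 := card_inter_add_of_union_eq hF hG h Finset.univ
  have s2 := card_inter_add_of_union_eq hF hG h (D.delta V₁ V₂)
  have s3 := card_inter_add_of_union_eq hF hG h (D.delta V₁ V₂)ᶜ
  simp only [Finset.inter_univ] at s1
  simp only [← Finset.sdiff_eq_inter_compl] at s3
  zify at s1 s2 s3
  rw [s1, s2, s3] at eG
  zify
  linarith

/-- Replacing two bibranchings of a partition by two with the same union. -/
theorem IsBibranchingPartition.update {D : ArcDigraph V A} {V₁ V₂ : Finset V} {k : ℕ}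
    {F : Fin k → Finset A} (hF : D.IsBibranchingPartition V₁ V₂ F) {i j : Fin k} (hij : i ≠ j)
    {G₁ G₂ : Finset A} (hd : Disjoint G₁ G₂) (hU : G₁ ∪ G₂ = F i ∪ F j)
    (h₁ : D.IsBibranching V₁ V₂ G₁) (h₂ : D.IsBibranching V₁ V₂ G₂) :
    D.IsBibranchingPartition V₁ V₂ (Function.update (Function.update F i G₁) j G₂) := by
  set F' := Function.update (Function.update F i G₁) j G₂ with hF'
  have ei : F' i = G₁ := by simp [hF', hij]
  have ej : F' j = G₂ := by simp [hF']
  have eo : ∀ l, l ≠ i → l ≠ j → F' l = F l := fun l h h' => by simp [hF', h, h']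
  have hsub : ∀ l, l ≠ i → l ≠ j → Disjoint (F l) (G₁ ∪ G₂) := fun l h h' => by
    rw [hU]; exact Finset.disjoint_union_right.2 ⟨hF.disjoint l i h, hF.disjoint l j h'⟩
  refine ⟨fun l => ?_, fun l m hlm => ?_, fun a => ?_⟩
  · by_cases hi : l = i
    · subst hi; rwa [ei]
    by_cases hj : l = j
    · subst hj; rwa [ej]
    rw [eo l hi hj]; exact hF.bibranching l
  · have one : ∀ l m, l ≠ m → l ≠ i → l ≠ j → Disjoint (F' l) (F' m) := by
      intro l m hlm hi hj
      have := Finset.disjoint_union_right.1 (hsub l hi hj)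
      rw [eo l hi hj]
      by_cases hi' : m = i
      · subst hi'; rw [ei]; exact this.1
      by_cases hj' : m = j
      · subst hj'; rw [ej]; exact this.2
      rw [eo m hi' hj']; exact hF.disjoint l m hlm
    by_cases hl : l ≠ i ∧ l ≠ j
    · exact one l m hlm hl.1 hl.2
    by_cases hm : m ≠ i ∧ m ≠ j
    · exact (one m l hlm.symm hm.1 hm.2).symm
    have : l = i ∧ m = j ∨ l = j ∧ m = i := by
      by_cases l = i <;> by_cases l = j <;> by_cases m = i <;> by_cases m = j <;> simp_all
    rcases this with ⟨rfl, rfl⟩ | ⟨rfl, rfl⟩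
    · rwa [ei, ej]
    · rw [ei, ej]; exact hd.symm
  · obtain ⟨l, hl⟩ := hF.cover a
    by_cases hlij : l = i ∨ l = j
    · have : a ∈ G₁ ∪ G₂ := by
        rw [hU, Finset.mem_union]
        rcases hlij with rfl | rfl
        · exact Or.inl hl
        · exact Or.inr hl
      rcases Finset.mem_union.1 this with h | h
      · exact ⟨i, ei ▸ h⟩
      · exact ⟨j, ej ▸ h⟩
    · push Not at hlij
      exact ⟨l, (eo l hlij.1 hlij.2) ▸ hl⟩

theorem sum_update_update_lt {ι α : Type*} [Fintype ι] [DecidableEq ι] (w : α → ℕ) (F : ι → α)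
    {i j : ι} (hij : i ≠ j) {x y : α} (h : w x + w y < w (F i) + w (F j)) :
    ∑ l, w (Function.update (Function.update F i x) j y l) < ∑ l, w (F l) := by
  rw [← Finset.add_sum_erase _ _ (Finset.mem_univ j),
    ← Finset.add_sum_erase _ (fun l => w (F l)) (Finset.mem_univ j),
    ← Finset.add_sum_erase (Finset.univ.erase j) _ (show i ∈ _ by simp [hij]),
    ← Finset.add_sum_erase (Finset.univ.erase j) (fun l => w (F l)) (show i ∈ _ by simp [hij])]
  have : ∑ l ∈ (Finset.univ.erase j).erase i, w (Function.update (Function.update F i x) j y l) =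
      ∑ l ∈ (Finset.univ.erase j).erase i, w (F l) := by
    refine Finset.sum_congr rfl fun l hl => ?_
    simp only [Finset.mem_erase] at hl
    rw [Function.update_of_ne hl.2.1, Function.update_of_ne hl.1]
  rw [this, Function.update_self, Function.update_of_ne hij, Function.update_self]
  omega

end ArcDigraph

theorem mainTheorem10 {V A : Type*} [Fintype V] [DecidableEq V] [Fintype A] [DecidableEq A]
    (D : ArcDigraph V A) (V₁ V₂ : Finset V) (hD : D.IsVertexPartition V₁ V₂) (k : ℕ)
    (h : ∃ F : Fin k → Finset A, D.IsBibranchingPartition V₁ V₂ F) :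
    ∃ F : Fin k → Finset A, D.IsBibranchingPartition V₁ V₂ F ∧
      ∀ i j : Fin k,
        |((F i).card : ℤ) - ((F j).card : ℤ)| ≤ 1 ∧
        |((F i ∩ D.delta V₁ V₂).card : ℤ) - ((F j ∩ D.delta V₁ V₂).card : ℤ)| ≤ 2 ∧
        |((F i \ D.delta V₁ V₂).card : ℤ) - ((F j \ D.delta V₁ V₂).card : ℤ)| ≤ 2 := by
  classical
  obtain ⟨F, hF, hmin⟩ := Set.exists_min_image {F | D.IsBibranchingPartition V₁ V₂ F}
    (fun F : Fin k → Finset A => ∑ l, D.weight V₁ V₂ (F l)) (Set.toFinite _) h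
  refine ⟨F, hF, fun i j => ?_⟩
  by_contra hcon
  have hij : i ≠ j := by
    rintro rfl
    simp at hcon
  obtain ⟨G₁, G₂, hd, hU, h₁, h₂, hb⟩ := hD.exists_balanced_pair (hF.disjoint i j hij)
    (hF.bibranching i) (hF.bibranching j)
  exact absurd (hmin _ (hF.update hij hd hU h₁ h₂)) (not_le.2
    (ArcDigraph.sum_update_update_lt (D.weight V₁ V₂) F hij
      (ArcDigraph.weight_add_weight_lt (hF.disjoint i j hij) hd hU hb hcon)))
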